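/- Let $(X,d_X)$ and $(Y,d_Y)$ be non-empty compact metric spaces, and let $T:X\to X$ and $S:Y\to Y$ be continuous maps. Let $\mathcal{M}_T(X)$ and $\mathcal{M}_S(Y)$ denote the sets of $T$-invariant Borel probability measures on $X$ and of $S$-invariant Borel probability measures on $Y$. Let $A_1,A_2:X\times Y\to\mathbb{R}$ be Lipschitz continuous with respect to the metric $d((x,y),(x',y'))=d_X(x,x')+d_Y(y,y')$, and for $i=1,2$ put $$\varphi_i(\mu,\nu)=\int_{X\times Y}A_i\,d(\mu\times\nu),\qquad \mu\in\mathcal{M}_T(X),\ \nu\in\mathcal{M}_S(Y).$$ Define the best-response sets $$BR_1(\nu)=\{\mu\in\mathcal{M}_T(X):\ \varphi_1(\mu,\nu)\ge\varphi_1(\eta,\nu)\ \text{ for all }\eta\in\mathcal{M}_T(X)\},$$ $$BR_2(\mu)=\{\nu\in\mathcal{M}_S(Y):\ \varphi_2(\mu,\nu)\ge\varphi_2(\mu,\eta)\ \text{ for all }\eta\in\mathcal{M}_S(Y)\}.$$ Then the game with these strategies and payoffs has a Nash equilibrium: there is a pair $(\bar\mu,\bar\nu)\in\mathcal{M}_T(X)\times\mathcal{M}_S(Y)$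 such that $\bar\mu\in BR_1(\bar\nu)$ and $\bar\nu\in BR_2(\bar\mu)$. -/

import Mathlib

open MeasureTheory

noncomputable section

namespace ErgodicGame

variable {X Y : Type*}

/-- The set of `T`-invariant Borel probability measures on `X`: those `μ` with `T_* μ = μ`.
For a game played with `T` on `X`, this is the set of strategies of the player. -/
def invariantMeasures [MeasurableSpace X] (T : X → X) : Set (ProbabilityMeasure X) :=
  {μ | MeasurePreserving T (μ : Measure X) (μ : Measure X)}

/-- `A : X × Y → ℝ` is Lipschitz continuous for the metric
`d ((x, y), (x', y')) = d x x' + d y y'` on the product. -/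
def IsLipschitzPotential [MetricSpace X] [MetricSpace Y] (A : X × Y → ℝ) : Prop :=
  ∃ L : ℝ, ∀ p q : X × Y, |A p - A q| ≤ L * (dist p.1 q.1 + dist p.2 q.2)

/-- The payoff `φ(μ, ν) = ∫ A d(μ × ν)` with potential `A`. -/
def payoff [MeasurableSpace X] [MeasurableSpace Y] (A : X × Y → ℝ)
    (μ : ProbabilityMeasure X) (ν : ProbabilityMeasure Y) : ℝ :=
  ∫ p, A p ∂((μ : Measure X).prod (ν : Measure Y))

/-- Best responses of player 1, whose payoff has potential `A₁`, to the strategy `ν`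
of player 2. -/
def bestResponse₁ [MeasurableSpace X] [MeasurableSpace Y] (T : X → X) (A₁ : X × Y → ℝ)
    (ν : ProbabilityMeasure Y) : Set (ProbabilityMeasure X) :=
  {μ | μ ∈ invariantMeasures T ∧ ∀ η ∈ invariantMeasures T, payoff A₁ η ν ≤ payoff A₁ μ ν}

/-- Best responses of player 2, whose payoff has potential `A₂`, to the strategy `μ`
of player 1. -/
def bestResponse₂ [MeasurableSpace X] [MeasurableSpace Y] (S : Y → Y) (A₂ : X × Y → ℝ)
    (μ : ProbabilityMeasure X) : Set (ProbabilityMeasure Y) :=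
  {ν | ν ∈ invariantMeasures S ∧ ∀ η ∈ invariantMeasures S, payoff A₂ μ η ≤ payoff A₂ μ ν}

/-- A Nash equilibrium: a pair of strategies, each of which is a best response to the other. -/
structure IsNashEquilibrium [MeasurableSpace X] [MeasurableSpace Y] (T : X → X) (S : Y → Y)
    (A₁ A₂ : X × Y → ℝ) (μ : ProbabilityMeasure X) (ν : ProbabilityMeasure Y) : Prop where
  strategy₁ : μ ∈ invariantMeasures T
  strategy₂ : ν ∈ invariantMeasures S
  best₁ : μ ∈ bestResponse₁ T A₁ ν
  best₂ : ν ∈ bestResponse₂ S A₂ μ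

end ErgodicGame

end

/-! A profile z is an equilibrium as soon as the Nikaidô–Isoda function Φ(z, w) (`deviationGain`) is
nonpositive for every w in the set K of invariant profiles. K is weakly compact and the payoffs are
jointly continuous, so finitely many w_i may be treated at a time. On the simplex of their mixtures
z(x), the field g_i(x) = Φ(z(x), w_i) is continuous, and ∑ x_i g_i(x) = Φ(z(x), z(x)) = 0 because
each payoff is affine in its own player's strategy; `exists_stdSimplex_nonpos` then gives x with all
g_i(x) ≤ 0.

That lemma plays the part of Brouwer's theorem. Label each point of a fine grid by a maximal
coordinate of g. Scarf's lemma, a parity count, finds nearby points carrying every label whose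
coordinate is not small, and a limit point is supported on maximal coordinates of g. -/

namespace Scarf

/-! ### Dominant sets and pivots -/

variable {V I : Type*}

/-- A set `R` is dominant for the family of orders `u` if no element lies strictly above the
minimum of `R` in every order. -/
def Dominant (u : I → V → ℕ) (R : Finset V) : Prop :=
  ∀ y, ∃ i, ∀ x ∈ R, u i y ≤ u i x

theorem Dominant.mono {u : I → V → ℕ} {R R' : Finset V} (h : Dominant u R) (hR : R' ⊆ R) :
    Dominant u R' := fun y => by
  obtain ⟨i, hi⟩ := h y
  exact ⟨i, fun x hx => hi x (hR hx)⟩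

/-- The elements exceeding the minima `m i` in all orders but the `a`-th, and maximal in the
`a`-th order among those. -/
def IsPivot (u : I → V → ℕ) (m : I → V) (a : I) (y : V) : Prop :=
  (∀ i, i ≠ a → u i (m i) < u i y) ∧
    ∀ z, (∀ i, i ≠ a → u i (m i) < u i z) → u a z ≤ u a y

theorem existsUnique_isPivot [Finite V] {u : I → V → ℕ} {m : I → V} {a : I}
    (hu : ∀ i, Function.Injective (u i)) (h : ∃ z, ∀ i, i ≠ a → u i (m i) < u i z) :
    ∃! y, IsPivot u m a y := by
  obtain ⟨y, hy, hmax⟩ := Set.exists_max_image {z | ∀ i, i ≠ a → u i (m i) < u i z} (u a)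
    (Set.toFinite _) h
  exact ⟨y, ⟨hy, hmax⟩, fun y' hy' => hu a (le_antisymm (hmax y' hy'.1) (hy'.2 y hy))⟩

theorem notMem_of_isPivot {u : I → V → ℕ} {τ : Finset V} {m : I → V} {a b : I} (hab : a ≠ b) (hmab : m a = m b)
    (hsurj : ∀ x ∈ τ, ∃ i, m i = x) {y : V} (hy : IsPivot u m a y) : y ∉ τ := by
  intro hyτ
  obtain ⟨i, rfl⟩ := hsurj y hyτ
  by_cases hia : i = a
  · subst hia
    exact absurd (hy.1 b hab.symm) (by rw [hmab]; exact lt_irrefl _)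
  · exact lt_irrefl _ (hy.1 i hia)

section Door

variable [DecidableEq V] [Fintype I] [DecidableEq I] {u : I → V → ℕ}

/-- An element above all minima except the `a`-th can only be blocked by order `a`, where `y` is
maximal among such elements. Any other element is blocked by some order `i ≠ a`, whose minimum `y`
does not lower. -/
theorem dominant_insert_of_isPivot {τ : Finset V} {m : I → V} {a : I}
    (hτ : Dominant u τ) (hm : ∀ i, m i ∈ τ) (hmin : ∀ i, ∀ x ∈ τ, u i (m i) ≤ u i x)
    {y : V} (hy : IsPivot u m a y) : Dominant u (insert y τ) := by
  intro z
  by_cases hz : ∀ i, i ≠ a → u i (m i) < u i z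
  · obtain ⟨i, hi⟩ := hτ z
    obtain rfl : i = a := by
      by_contra hia
      exact absurd (hi _ (hm i)) (not_le.2 (hz i hia))
    refine ⟨i, fun x hx => ?_⟩
    rcases Finset.mem_insert.1 hx with rfl | hx
    · exact hy.2 z hz
    · exact hi x hx
  · push Not at hz
    obtain ⟨i, hia, hi⟩ := hz
    refine ⟨i, fun x hx => ?_⟩
    rcases Finset.mem_insert.1 hx with rfl | hx
    · exact hi.trans (hy.1 i hia).le
    · exact hi.trans (hmin i x hx)

/-- If order `k` blocks `y`, each element of `τ` is the minimum of some order other than `k`. By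
counting, `m` is injective off `k`, so the collision `m a = m b` forces `k` to be `a` or `b`. -/
theorem isPivot_of_dominant_insert {τ : Finset V} {m : I → V} {a b : I}
    (hu : ∀ i, Function.Injective (u i)) (hcard : τ.card + 1 = Fintype.card I)
    (hm : ∀ i, m i ∈ τ) (hmin : ∀ i, ∀ x ∈ τ, u i (m i) ≤ u i x)
    (hab : a ≠ b) (hmab : m a = m b) {y : V} (hyτ : y ∉ τ) (hd : Dominant u (insert y τ)) :
    IsPivot u m a y ∨ IsPivot u m b y := by
  obtain ⟨k, hk⟩ := hd y
  have key : ∀ x ∈ τ, ∃ i, i ≠ k ∧ m i = x ∧ u i x < u i y := by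
    intro x hx
    have hxy : x ≠ y := fun h => hyτ (h ▸ hx)
    obtain ⟨i, hi⟩ := hd x
    refine ⟨i, ?_, ?_, ?_⟩
    · rintro rfl
      exact hxy (hu i (le_antisymm (hi y (Finset.mem_insert_self _ _))
        (hk x (Finset.mem_insert_of_mem hx))))
    · exact hu i (le_antisymm (hmin i x hx) (hi _ (Finset.mem_insert_of_mem (hm i))))
    · exact lt_of_le_of_ne (hi y (Finset.mem_insert_self _ _)) fun h => hxy (hu i h)
  have hinj : Set.InjOn m ((Finset.univ.erase k : Finset I) : Set I) := by
    refine Finset.injOn_of_surjOn_of_card_le m (t := τ) (fun i _ => hm i) ?_ ?_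
    · intro x hx
      obtain ⟨i, hik, hix, -⟩ := key x hx
      exact ⟨i, by simpa using hik, hix⟩
    · rw [Finset.card_erase_of_mem (Finset.mem_univ _), Finset.card_univ]
      omega
  have hpiv : IsPivot u m k y := by
    refine ⟨fun i hik => ?_, fun z hz => ?_⟩
    · obtain ⟨j, hjk, hj, hlt⟩ := key (m i) (hm i)
      obtain rfl : j = i := hinj (by simpa using hjk) (by simpa using hik) hj
      exact hlt
    · obtain ⟨i, hi⟩ := hd z
      obtain rfl : i = k := by
        by_contra hik
        exact absurd (hi _ (Finset.mem_insert_of_mem (hm i))) (not_le.2 (hz i hik))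
      exact hi y (Finset.mem_insert_self _ _)
  by_cases hka : k = a
  · exact Or.inl (hka ▸ hpiv)
  by_cases hkb : k = b
  · exact Or.inr (hkb ▸ hpiv)
  exact absurd (hinj (by simpa using Ne.symm hka) (by simpa using Ne.symm hkb) hmab) hab

open Classical in
/-- A nonempty dominant set of one element less than the number of orders extends to exactly two
dominant sets, provided that some element can be raised in all orders but any given one. -/
theorem card_extensions_eq_two [Fintype V] {τ : Finset V}
    (hu : ∀ i, Function.Injective (u i)) (hcard : τ.card + 1 = Fintype.card I)
    (hτ : Dominant u τ) (hne : τ.Nonempty)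
    (hup : ∀ a, ∃ z, ∀ i, i ≠ a → ∃ x ∈ τ, u i x < u i z) :
    (Finset.univ.filter fun y => y ∉ τ ∧ Dominant u (insert y τ)).card = 2 := by
  choose m hm hmin using fun i => Finset.exists_min_image τ (u i) hne
  have hsurj : ∀ x ∈ τ, ∃ i, m i = x := fun x hx => by
    obtain ⟨i, hi⟩ := hτ x
    exact ⟨i, hu i (le_antisymm (hmin i x hx) (hi _ (hm i)))⟩
  obtain ⟨a, -, b, -, hab, hmab⟩ := Finset.exists_ne_map_eq_of_card_lt_of_maps_to
    (s := (Finset.univ : Finset I)) (t := τ) (by rw [Finset.card_univ]; omega)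
    (f := m) (fun i _ => hm i)
  have hex : ∀ a, ∃! y, IsPivot u m a y := fun a => existsUnique_isPivot hu <| by
    obtain ⟨z, hz⟩ := hup a
    refine ⟨z, fun i hi => ?_⟩
    obtain ⟨x, hx, hlt⟩ := hz i hi
    exact (hmin i x hx).trans_lt hlt
  obtain ⟨ya, hya, hya'⟩ := hex a
  obtain ⟨yb, hyb, hyb'⟩ := hex b
  rw [Finset.card_eq_two]
  refine ⟨ya, yb, ?_, ?_⟩
  -- A common pivot would exceed the minimum of `τ` in every order.
  · rintro rfl
    obtain ⟨i, hi⟩ := hτ ya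
    by_cases hia : i = a
    · exact absurd (hi _ (hm i)) (not_le.2 (hyb.1 i (hia ▸ hab)))
    · exact absurd (hi _ (hm i)) (not_le.2 (hya.1 i hia))
  · ext y
    simp only [Finset.mem_filter, Finset.mem_univ, true_and, Finset.mem_insert,
      Finset.mem_singleton]
    constructor
    · rintro ⟨hyτ, hd⟩
      exact (isPivot_of_dominant_insert hu hcard hm hmin hab hmab hyτ hd).imp (hya' y) (hyb' y)
    · rintro (rfl | rfl)
      · exact ⟨notMem_of_isPivot hab hmab hsurj hya, dominant_insert_of_isPivot hτ hm hmin hya⟩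
      · exact ⟨notMem_of_isPivot hab.symm hmab.symm hsurj hyb,
          dominant_insert_of_isPivot hτ hm hmin hyb⟩

/-- A set with as many elements as there are colours, not all of which occur, has an even number
of elements whose removal leaves exactly the colours other than `i₀`. -/
theorem even_card_filter_image_erase {R : Finset V} {c : V → I} {i₀ : I}
    (hcard : R.card = Fintype.card I) (hR : R.image c ≠ Finset.univ) :
    Even (R.filter fun x => (R.erase x).image c = Finset.univ.erase i₀).card := by
  rcases (R.filter fun x => (R.erase x).image c = Finset.univ.erase i₀).eq_empty_or_nonempty
    with h | ⟨x, hx⟩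
  · simp [h]
  obtain ⟨hxR, hx⟩ := Finset.mem_filter.1 hx
  have hinj : ∀ y ∈ R, (R.erase y).image c = Finset.univ.erase i₀ →
      Set.InjOn c ((R.erase y : Finset V) : Set V) := by
    intro y hy h
    rw [← Finset.card_image_iff, h, Finset.card_erase_of_mem (Finset.mem_univ _),
      Finset.card_erase_of_mem hy, hcard, Finset.card_univ]
  have himg : R.image c = insert (c x) ((R.erase x).image c) := by
    rw [← Finset.image_insert, Finset.insert_erase hxR]
  -- The colour of `x` thus recurs at exactly one other element `x'`, and only `x` and `x'` can be
  -- removed.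
  have hcx : c x ≠ i₀ := by
    rintro rfl
    exact hR (by rw [himg, hx, Finset.insert_erase (Finset.mem_univ _)])
  have hmem : c x ∈ (R.erase x).image c := by rw [hx]; simpa using hcx
  obtain ⟨x', hx', hcxx'⟩ := Finset.mem_image.1 hmem
  obtain ⟨hne, hx'R⟩ := Finset.mem_erase.1 hx'
  have himg' : (R.erase x').image c = Finset.univ.erase i₀ := by
    rw [Finset.insert_eq_of_mem hmem, hx] at himg
    rw [← himg]
    refine (Finset.image_subset_image (Finset.erase_subset _ _)).antisymm fun i hi => ?_
    obtain ⟨y, hy, rfl⟩ := Finset.mem_image.1 hi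
    by_cases hyx : y = x'
    · exact Finset.mem_image.2 ⟨x, Finset.mem_erase.2 ⟨hne.symm, hxR⟩, by rw [hyx, hcxx']⟩
    · exact Finset.mem_image_of_mem _ (Finset.mem_erase.2 ⟨hyx, hy⟩)
  have : (R.filter fun x => (R.erase x).image c = Finset.univ.erase i₀) = {x, x'} := by
    ext y
    simp only [Finset.mem_filter, Finset.mem_insert, Finset.mem_singleton]
    constructor
    · rintro ⟨hy, h⟩
      by_contra! hcon
      exact hne (hinj y hy h (by simpa using ⟨hx'R, hcon.2.symm⟩)
        (by simpa using ⟨hxR, hcon.1.symm⟩) hcxx')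
    · rintro (rfl | rfl)
      · exact ⟨hxR, hx⟩
      · exact ⟨hx'R, himg'⟩
  rw [this, Finset.card_pair hne.symm]
  exact even_two

end Door

/-! ### Scarf's lemma by parity -/

section Slack

variable [Fintype V] [DecidableEq V] [Fintype I] [DecidableEq I] {u : I → V → ℕ} {s : I → V}

open Classical in
/-- The boundary set of all slack elements but one has a unique dominant extension. -/
theorem card_extensions_slack (hu : ∀ i, Function.Injective (u i)) (hs : Function.Injective s)
    (hbot : ∀ i v, v ≠ s i → u i (s i) < u i v)
    (htop : ∀ i j v, j ≠ i → v ∉ Set.range s → u i v < u i (s j)) (i₀ : I) :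
    (Finset.univ.filter fun y => y ∉ (Finset.univ.erase i₀).image s ∧
      Dominant u (insert y ((Finset.univ.erase i₀).image s))).card = 1 := by
  set τ := (Finset.univ.erase i₀).image s with hτdef
  have hτ : ∀ x, x ∈ τ ↔ ∃ i, i ≠ i₀ ∧ s i = x := fun x => by simp [hτdef]
  obtain ⟨y, hy, hmax⟩ := Set.exists_max_image {z | z ∉ τ} (u i₀) (Set.toFinite _)
    ⟨s i₀, fun h => by
      obtain ⟨i, hi, h⟩ := (hτ _).1 h
      exact hi (hs h)⟩
  rw [Finset.card_eq_one]
  refine ⟨y, ?_⟩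
  ext y'
  simp only [Finset.mem_filter, Finset.mem_univ, true_and, Finset.mem_singleton]
  constructor
  · rintro ⟨hy', hd⟩
    refine hu i₀ (le_antisymm (hmax y' hy') ?_)
    obtain ⟨i, hi⟩ := hd y
    by_cases hii : i = i₀
    · exact hii ▸ hi y' (Finset.mem_insert_self _ _)
    · have hsi : s i ∈ τ := (hτ _).2 ⟨i, hii, rfl⟩
      exact absurd (hi _ (Finset.mem_insert_of_mem hsi))
        (not_le.2 (hbot i y fun h => hy (h ▸ hsi)))
  · rintro rfl
    refine ⟨hy, fun z => ?_⟩
    by_cases hz : z ∈ τ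
    · obtain ⟨i, hi, rfl⟩ := (hτ _).1 hz
      refine ⟨i, fun x _ => ?_⟩
      by_cases hx : x = s i
      · rw [hx]
      · exact (hbot i x hx).le
    · refine ⟨i₀, fun x hx => ?_⟩
      rcases Finset.mem_insert.1 hx with rfl | hx
      · exact hmax z hz
      · obtain ⟨i, hi, rfl⟩ := (hτ _).1 hx
        by_cases hzs : z ∈ Set.range s
        · obtain ⟨j, rfl⟩ := hzs
          obtain rfl : j = i₀ := by
            by_contra hj
            exact hz ((hτ _).2 ⟨j, hj, rfl⟩)
          exact (hbot j (s i) fun h => hi (hs h)).le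
        · exact (htop i₀ i z hi hzs).le

-- The non-slack `t` lies below the slack `s a` in every order but `a`, so slack elements provide
-- the raising that `card_extensions_eq_two` requires. If `τ` is not dominant, no extension is.
open Classical in
theorem even_card_extensions (hu : ∀ i, Function.Injective (u i))
    (htop : ∀ i j v, j ≠ i → v ∉ Set.range s → u i v < u i (s j))
    {τ : Finset V} (hcard : τ.card + 1 = Fintype.card I) {t : V} (ht : t ∈ τ)
    (hts : t ∉ Set.range s) :
    Even (Finset.univ.filter fun y => y ∉ τ ∧ Dominant u (insert y τ)).card := by
  by_cases hτ : Dominant u τ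
  · rw [card_extensions_eq_two hu hcard hτ ⟨t, ht⟩
      fun a => ⟨s a, fun i hi => ⟨t, ht, htop i a t hi.symm hts⟩⟩]
    exact even_two
  · rw [Finset.filter_false_of_mem fun y _ h => hτ (h.2.mono (Finset.subset_insert _ _))]
    simp

/-- **Scarf's lemma.** -/
theorem exists_dominant_image_eq_univ [Nonempty I] (hu : ∀ i, Function.Injective (u i))
    (hs : Function.Injective s) (hbot : ∀ i v, v ≠ s i → u i (s i) < u i v)
    (htop : ∀ i j v, j ≠ i → v ∉ Set.range s → u i v < u i (s j))
    (c : V → I) (hc : ∀ i, c (s i) = i) :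
    ∃ R : Finset V, R.card = Fintype.card I ∧ Dominant u R ∧ R.image c = Finset.univ := by
  classical
  by_contra! hcon
  obtain ⟨i₀⟩ := ‹Nonempty I›
  -- Count the pairs τ ⊂ R = τ ∪ {y} twice. Without a fully coloured R, every R contributes an even
  -- number; so does every τ, except the all-slack one, which contributes 1.
  set D : Finset (Finset V) := Finset.univ.filter fun τ =>
    τ.card + 1 = Fintype.card I ∧ τ.image c = Finset.univ.erase i₀ with hD
  set Q : Finset (Finset V) := Finset.univ.filter fun R =>
    R.card = Fintype.card I ∧ Dominant u R with hQ
  set exts : Finset V → Finset V := fun τ =>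
    Finset.univ.filter fun y => y ∉ τ ∧ Dominant u (insert y τ) with hexts
  set rem : Finset V → Finset V := fun R =>
    R.filter fun x => (R.erase x).image c = Finset.univ.erase i₀ with hrem
  have hcount : ∑ τ ∈ D, (exts τ).card = ∑ R ∈ Q, (rem R).card := by
    rw [← Finset.card_sigma, ← Finset.card_sigma]
    refine Finset.card_bij' (fun p _ => ⟨insert p.2 p.1, p.2⟩) (fun p _ => ⟨p.1.erase p.2, p.2⟩)
      ?_ ?_ ?_ ?_
    · rintro ⟨τ, y⟩ h
      simp only [hD, hexts, hQ, hrem, Finset.mem_sigma, Finset.mem_filter, Finset.mem_univ,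
        true_and, Finset.mem_insert_self] at h ⊢
      obtain ⟨⟨h1, h2⟩, h3, h4⟩ := h
      rw [Finset.card_insert_of_notMem h3, Finset.erase_insert h3]
      exact ⟨⟨h1, h4⟩, h2⟩
    · rintro ⟨R, x⟩ h
      simp only [hD, hexts, hQ, hrem, Finset.mem_sigma, Finset.mem_filter, Finset.mem_univ,
        true_and] at h ⊢
      obtain ⟨⟨h1, h2⟩, h3, h4⟩ := h
      rw [Finset.card_erase_add_one h3, Finset.insert_erase h3]
      exact ⟨⟨h1, h4⟩, Finset.notMem_erase _ _, h2⟩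
    · rintro ⟨τ, y⟩ h
      simp only [hexts, Finset.mem_sigma, Finset.mem_filter] at h
      simp only [Finset.erase_insert h.2.2.1]
    · rintro ⟨R, x⟩ h
      simp only [hrem, Finset.mem_sigma, Finset.mem_filter] at h
      simp only [Finset.insert_erase h.2.1]
  have heven : Even (∑ R ∈ Q, (rem R).card) := Finset.even_sum _ fun R hR => by
    obtain ⟨-, h1, h2⟩ := Finset.mem_filter.1 hR
    exact even_card_filter_image_erase h1 (hcon R h1 h2)
  have hτ₀ : (Finset.univ.erase i₀).image s ∈ D := by
    refine Finset.mem_filter.2 ⟨Finset.mem_univ _, ?_, ?_⟩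
    · rw [Finset.card_image_of_injective _ hs, Finset.card_erase_add_one (Finset.mem_univ _),
        Finset.card_univ]
    · rw [Finset.image_image]
      simp [Function.comp_def, hc]
  rw [← hcount, ← Finset.add_sum_erase _ _ hτ₀] at heven
  have h1 : (exts ((Finset.univ.erase i₀).image s)).card = 1 :=
    card_extensions_slack hu hs hbot htop i₀
  rw [h1, Nat.even_add] at heven
  refine absurd (heven.2 (Finset.even_sum _ fun τ hτ => ?_)) (by decide)
  obtain ⟨hne, hτ⟩ := Finset.mem_erase.1 hτ
  obtain ⟨-, hcard, himg⟩ := Finset.mem_filter.1 hτ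
  by_cases hts : ∃ t ∈ τ, t ∉ Set.range s
  · obtain ⟨t, ht, hts⟩ := hts
    exact even_card_extensions hu htop hcard ht hts
  -- Slack elements carry their own index as colour, so an all-slack τ missing only the colour `i₀`
  -- is the excluded one.
  · push Not at hts
    refine absurd (Finset.eq_of_subset_of_card_le (fun x hx => ?_) ?_) hne
    · obtain ⟨i, rfl⟩ := hts x hx
      have : c (s i) ∈ τ.image c := Finset.mem_image_of_mem _ hx
      rw [himg, hc] at this
      exact Finset.mem_image_of_mem _ this
    · rw [Finset.card_image_of_injective _ hs, Finset.card_erase_of_mem (Finset.mem_univ _),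
        Finset.card_univ]
      omega

end Slack

end Scarf

/-! ### From labelled grids to vector fields on the simplex -/

namespace Scarf

open Filter Topology

variable {I : Type*} [Fintype I]

/-- The integer points of the simplex of size `N`. -/
abbrev Grid (I : Type*) [Fintype I] (N : ℕ) : Type _ := {a : I → ℕ // ∑ i, a i = N}

/-- Every labelling of the integer points of the simplex of size `N` has a point around which all
the labels of the coordinates not close to zero occur. -/
theorem exists_grid_point [DecidableEq I] [Nonempty I] (N : ℕ) (c : Grid I N → I) :
    ∃ x : Grid I N, ∀ i, Fintype.card I ≤ x.1 i →
      ∃ y, c y = i ∧ ∀ j, x.1 j ≤ y.1 j + Fintype.card I ∧ y.1 j ≤ x.1 j + Fintype.card I := by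
  classical
  have hle : ∀ (a : Grid I N) i, a.1 i ≤ N := fun a i =>
    (Finset.single_le_sum (fun j _ => Nat.zero_le (a.1 j)) (Finset.mem_univ i)).trans a.2.le
  have : Finite (Grid I N) := Finite.of_injective
    (fun a i => (⟨a.1 i, Nat.lt_succ_of_le (hle a i)⟩ : Fin (N + 1))) fun a b h => by
      ext i
      simpa using congrFun h i
  have := Fintype.ofFinite (Grid I N)
  set M := Fintype.card (Grid I N) with hM
  set e := Fintype.equivFin (Grid I N)
  set f := Fintype.equivFin I
  -- Order `i` compares `i`-th coordinates, ties being broken by `e`, whose values stay below `M`.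
  -- The leading 1 leaves 0 to slack element `i`; the other slacks lie above all grid points.
  let u : I → Grid I N ⊕ I → ℕ := fun i v => Sum.elim (fun a => 1 + (M * a.1 i + e a))
    (fun j => if j = i then 0 else 1 + (M * (N + 1) + f j)) v
  have hul : ∀ i a, u i (Sum.inl a) = 1 + (M * a.1 i + e a) := fun _ _ => rfl
  have hus : ∀ i, u i (Sum.inr i) = 0 := fun i => if_pos rfl
  have hur : ∀ i j, j ≠ i → u i (Sum.inr j) = 1 + (M * (N + 1) + f j) := fun i j h => if_neg h
  have hlt : ∀ (a b : Grid I N) i, a.1 i < b.1 i → u i (Sum.inl a) < u i (Sum.inl b) := by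
    intro a b i h
    rw [hul, hul]
    have h1 : M * (a.1 i + 1) ≤ M * b.1 i := Nat.mul_le_mul_left _ h
    have h2 : (e a : ℕ) < M := (e a).2
    rw [mul_add] at h1
    omega
  have htop' : ∀ (a : Grid I N) i j, j ≠ i → u i (Sum.inl a) < u i (Sum.inr j) := by
    intro a i j h
    rw [hul, hur i j h]
    have h1 : M * a.1 i ≤ M * N := Nat.mul_le_mul_left _ (hle a i)
    have h2 : (e a : ℕ) < M := (e a).2
    rw [mul_add]
    omega
  have hbot : ∀ i v, v ≠ Sum.inr i → u i (Sum.inr i) < u i v := by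
    rintro i (a | j) h
    · rw [hus, hul]; omega
    · rw [hus, hur i j fun h' => h (by rw [h'])]; omega
  have hu : ∀ i, Function.Injective (u i) := by
    rintro i (a | j) (b | k) h
    · rcases lt_trichotomy (a.1 i) (b.1 i) with h' | h' | h'
      · exact absurd h (hlt a b i h').ne
      · rw [hul, hul, h'] at h
        exact congrArg _ (e.injective (Fin.ext (by omega)))
      · exact absurd h (hlt b a i h').ne'
    · by_cases hk : k = i
      · subst hk
        exact absurd h (hbot k _ (by simp)).ne'
      · exact absurd h (htop' a i k hk).ne
    · by_cases hk : j = i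
      · subst hk
        exact absurd h (hbot j _ (by simp)).ne
      · exact absurd h (htop' b i j hk).ne'
    · by_cases hj : j = i
      · subst hj
        by_contra hne
        exact absurd h (hbot j _ (Ne.symm hne)).ne
      · by_cases hk : k = i
        · subst hk
          exact absurd h (hbot k _ (by simpa using hj)).ne'
        · rw [hur i j hj, hur i k hk] at h
          exact congrArg _ (f.injective (Fin.ext (by omega)))
  obtain ⟨R, hcard, hR, hcR⟩ := exists_dominant_image_eq_univ (s := Sum.inr) hu
    Sum.inr_injective hbot
    (by
      rintro i j (a | k) hj hv
      · exact htop' a i j hj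
      · exact absurd ⟨k, rfl⟩ hv)
    (Sum.elim c id) (fun _ => rfl)
  have hdom : ∀ y : Grid I N, ∃ i, Sum.inr i ∉ R ∧ ∀ x : Grid I N, Sum.inl x ∈ R → y.1 i ≤ x.1 i := by
    intro y
    obtain ⟨i, hi⟩ := hR (Sum.inl y)
    refine ⟨i, fun h => absurd (hi _ h) (not_le.2 (hbot i _ (by simp))), fun x hx => ?_⟩
    by_contra! hcon
    exact absurd (hi _ hx) (not_le.2 (hlt x y i hcon))
  have hcol : ∀ i, Sum.inr i ∉ R → ∃ x : Grid I N, Sum.inl x ∈ R ∧ c x = i := by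
    intro i hi
    have : i ∈ R.image (Sum.elim c id) := by rw [hcR]; exact Finset.mem_univ _
    obtain ⟨v | j, hv, h⟩ := Finset.mem_image.1 this
    · exact ⟨v, hv, h⟩
    · exact absurd (by rw [← show j = i from h]; exact hv) hi
  obtain ⟨i₁, hi₁, -⟩ := hdom ⟨Pi.single (Classical.arbitrary I) N, by simp⟩
  obtain ⟨x₀, hx₀, -⟩ := hcol i₁ hi₁
  set C : Finset I := Finset.univ.filter fun i => Sum.inr i ∉ R with hC
  have hCm : ∀ i, i ∈ C ↔ Sum.inr i ∉ R := fun i => by simp [hC]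
  have hmin : ∀ i, ∃ x : Grid I N, Sum.inl x ∈ R ∧ ∀ y : Grid I N, Sum.inl y ∈ R → x.1 i ≤ y.1 i := by
    intro i
    obtain ⟨x, hx, h⟩ := Set.exists_min_image {x : Grid I N | Sum.inl x ∈ R} (fun x => x.1 i)
      (Set.toFinite _) ⟨x₀, hx₀⟩
    exact ⟨x, hx, h⟩
  choose m hmR hm using hmin
  -- Otherwise some grid point exceeds the minima in all orders of `C`, against dominance; the
  -- leftover mass is put on `i₁`.
  have hsum : N < ∑ i ∈ C, ((m i).1 i + 1) := by
    by_contra! hcon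
    set b : I → ℕ := fun i => (if i ∈ C then (m i).1 i + 1 else 0) +
      (if i = i₁ then N - ∑ i ∈ C, ((m i).1 i + 1) else 0) with hb
    have hbN : ∑ i, b i = N := by
      rw [hb, Finset.sum_add_distrib]
      simp only [Finset.sum_ite_mem, Finset.univ_inter, Finset.sum_ite_eq', Finset.mem_univ,
        if_true]
      omega
    obtain ⟨i, hi, h⟩ := hdom ⟨b, hbN⟩
    have h1 := h _ (hmR i)
    simp only [hb, if_pos ((hCm i).2 hi)] at h1
    omega
  -- The coordinates of `x` sum to `N` and are at least the minima on `C`, so by `hsum` their total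
  -- excess is below `Fintype.card I`.
  have hclose : ∀ x : Grid I N, Sum.inl x ∈ R → ∀ i,
      (i ∈ C → x.1 i < (m i).1 i + Fintype.card I) ∧ (i ∉ C → x.1 i < Fintype.card I) := by
    intro x hx i
    have h1 : ∑ j ∈ C, ((m j).1 j + 1) ≤ ∑ j ∈ C, (m j).1 j + Fintype.card I := by
      rw [Finset.sum_add_distrib, Finset.sum_const, smul_eq_mul, mul_one]
      exact Nat.add_le_add_left (Finset.card_le_univ _) _
    have h2 : ∑ j ∈ C, x.1 j + ∑ j ∈ Cᶜ, x.1 j = N := by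
      rw [Finset.sum_add_sum_compl, x.2]
    have h3 : ∀ s ⊆ C, ∑ j ∈ s, (m j).1 j ≤ ∑ j ∈ s, x.1 j := fun s _ =>
      Finset.sum_le_sum fun j _ => hm j x hx
    constructor
    · intro hi
      have h4 := h3 (C.erase i) (Finset.erase_subset _ _)
      have h5 := Finset.add_sum_erase C (fun j => x.1 j) hi
      have h6 := Finset.add_sum_erase C (fun j => (m j).1 j) hi
      omega
    · intro hi
      have h4 := h3 C subset_rfl
      have h5 := Finset.single_le_sum (fun j _ => Nat.zero_le (x.1 j))
        (Finset.mem_compl.2 hi)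
      omega
  have hclose' : ∀ x y : Grid I N, Sum.inl x ∈ R → Sum.inl y ∈ R → ∀ i,
      x.1 i ≤ y.1 i + Fintype.card I := by
    intro x y hx hy i
    by_cases hi : i ∈ C
    · have h1 := (hclose x hx i).1 hi
      have h2 := hm i y hy
      omega
    · have h1 := (hclose x hx i).2 hi
      omega
  refine ⟨x₀, fun i hi => ?_⟩
  have hiC : i ∈ C := by
    by_contra h
    exact absurd hi (not_le.2 ((hclose x₀ hx₀ i).2 h))
  obtain ⟨y, hy, hcy⟩ := hcol i ((hCm i).1 hiC)
  exact ⟨y, hcy, fun j => ⟨hclose' x₀ y hx₀ hy j, hclose' y x₀ hy hx₀ j⟩⟩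

/-- A continuous vector field on the standard simplex has a point supported on its maximal
coordinates. -/
theorem exists_stdSimplex_support_maximal [Nonempty I] (g : stdSimplex ℝ I → I → ℝ)
    (hg : Continuous g) : ∃ x : stdSimplex ℝ I, ∀ i, 0 < x.1 i → ∀ j, g x j ≤ g x i := by
  classical
  choose c hc using fun x : stdSimplex ℝ I => Finite.exists_max (g x)
  let p : (N : ℕ) → Grid I (N + 1) → stdSimplex ℝ I := fun N a =>
    ⟨fun i => a.1 i / (N + 1 : ℝ), fun i => by positivity, by
      rw [← Finset.sum_div, show (∑ i, (a.1 i : ℝ)) = N + 1 by exact_mod_cast a.2,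
        div_self (by positivity)]⟩
  have hp : ∀ N a i, (p N a).1 i = a.1 i / (N + 1 : ℝ) := fun _ _ _ => rfl
  choose z hz using fun N : ℕ => exists_grid_point (N + 1) fun a => c (p N a)
  obtain ⟨x, φ, hφ, hlim⟩ := CompactSpace.tendsto_subseq fun N => p N (z N)
  have hlim' := tendsto_pi_nhds.1 ((continuous_subtype_val.tendsto x).comp hlim)
  simp only [Function.comp_apply, hp] at hlim'
  refine ⟨x, fun i hi j => ?_⟩
  obtain ⟨n, hn⟩ : ∃ n : ℝ, n = Fintype.card I := ⟨_, rfl⟩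
  have hnlim : Tendsto (fun k => n / ((φ k : ℕ) + 1 : ℝ)) atTop (𝓝 0) := by
    have h1 := ((tendsto_const_div_atTop_nhds_zero_nat n).comp
      (tendsto_add_atTop_nat 1)).comp hφ.tendsto_atTop
    simpa [Function.comp_def] using h1
  have hev : ∀ᶠ k in atTop, Fintype.card I ≤ (z (φ k)).1 i := by
    filter_upwards [hnlim.eventually_lt (hlim' i) hi] with k hk
    rw [div_lt_div_iff_of_pos_right (by positivity), hn] at hk
    exact_mod_cast hk.le
  -- The point is arbitrary when the coordinate is small; by `hev` this does not affect the limit.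
  have hq : ∀ k, ∃ y : Grid I (φ k + 1), Fintype.card I ≤ (z (φ k)).1 i → c (p (φ k) y) = i ∧
      ∀ j, (z (φ k)).1 j ≤ y.1 j + Fintype.card I ∧ y.1 j ≤ (z (φ k)).1 j + Fintype.card I := by
    intro k
    by_cases h : Fintype.card I ≤ (z (φ k)).1 i
    · obtain ⟨y, hy⟩ := hz (φ k) i h
      exact ⟨y, fun _ => hy⟩
    · exact ⟨z (φ k), fun h' => absurd h' h⟩
  choose y hy using hq
  have hylim : Tendsto (fun k => p (φ k) (y k)) atTop (𝓝 x) := by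
    rw [tendsto_subtype_rng, tendsto_pi_nhds]
    intro l
    refine tendsto_of_tendsto_of_tendsto_of_le_of_le'
      (by simpa using (hlim' l).sub hnlim) (by simpa using (hlim' l).add hnlim) ?_ ?_
    · filter_upwards [hev] with k hk
      have h2 : ((z (φ k)).1 l : ℝ) ≤ (y k).1 l + n := by
        rw [hn]; exact_mod_cast ((hy k hk).2 l).1
      rw [hp, ← sub_div]
      gcongr
      linarith
    · filter_upwards [hev] with k hk
      have h2 : ((y k).1 l : ℝ) ≤ (z (φ k)).1 l + n := by
        rw [hn]; exact_mod_cast ((hy k hk).2 l).2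
      rw [hp, ← add_div]
      gcongr
  have hglim := tendsto_pi_nhds.1 ((hg.tendsto x).comp hylim)
  refine le_of_tendsto_of_tendsto (hglim j) (hglim i) ?_
  filter_upwards [hev] with k hk
  have h := hc (p (φ k) (y k)) j
  rwa [(hy k hk).1] at h

/-- A continuous vector field on the standard simplex that is orthogonal to the position has a
point at which all its coordinates are nonpositive. -/
theorem exists_stdSimplex_nonpos [Nonempty I] (g : stdSimplex ℝ I → I → ℝ) (hg : Continuous g)
    (h0 : ∀ x, ∑ i, x.1 i * g x i = 0) : ∃ x, ∀ i, g x i ≤ 0 := by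
  obtain ⟨x, h⟩ := exists_stdSimplex_support_maximal g hg
  refine ⟨x, fun j => ?_⟩
  have h1 : ∑ i, x.1 i * g x j ≤ ∑ i, x.1 i * g x i := by
    refine Finset.sum_le_sum fun i _ => ?_
    rcases (x.2.1 i).eq_or_lt with h' | h'
    · simp [← h']
    · exact mul_le_mul_of_nonneg_left (h i h' j) h'.le
  rwa [h0 x, ← Finset.sum_mul, x.2.2, one_mul] at h1

end Scarf

/-! ### Mixtures of probability measures -/

namespace ErgodicGame

open Filter Topology BoundedContinuousFunction

section Mixture

variable {X I : Type*} [Fintype I] [MeasurableSpace X]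

/-- The convex combination of the probability measures `η i` with weights `w i`. -/
noncomputable def mixture (η : I → ProbabilityMeasure X) (w : stdSimplex ℝ I) :
    ProbabilityMeasure X :=
  ⟨∑ i, ENNReal.ofReal (w.1 i) • (η i : Measure X), ⟨by
    simp only [Measure.finsetSum_apply, Measure.smul_apply, measure_univ, smul_eq_mul, mul_one]
    rw [← ENNReal.ofReal_sum_of_nonneg fun i _ => w.2.1 i, w.2.2, ENNReal.ofReal_one]⟩⟩

theorem toMeasure_mixture (η : I → ProbabilityMeasure X) (w : stdSimplex ℝ I) :
    (mixture η w : Measure X) = ∑ i, ENNReal.ofReal (w.1 i) • (η i : Measure X) := rfl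

theorem integral_mixture (η : I → ProbabilityMeasure X) (w : stdSimplex ℝ I) {f : X → ℝ}
    (hf : ∀ i, Integrable f (η i : Measure X)) :
    ∫ x, f x ∂(mixture η w : Measure X) = ∑ i, w.1 i * ∫ x, f x ∂(η i : Measure X) := by
  rw [toMeasure_mixture,
    integral_finsetSum_measure fun i _ => (hf i).smul_measure ENNReal.ofReal_ne_top]
  refine Finset.sum_congr rfl fun i _ => ?_
  rw [integral_smul_measure, ENNReal.toReal_ofReal (w.2.1 i), smul_eq_mul]

theorem continuous_mixture [TopologicalSpace X] [OpensMeasurableSpace X]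
    (η : I → ProbabilityMeasure X) : Continuous (mixture η) := by
  rw [ProbabilityMeasure.continuous_iff_forall_continuous_integral]
  intro f
  simp only [integral_mixture η _ fun i => f.integrable (η i : Measure X)]
  exact continuous_finsetSum _ fun i _ =>
    ((continuous_apply i).comp continuous_subtype_val).mul continuous_const

theorem mixture_mem_invariantMeasures {T : X → X} (hT : Measurable T)
    {η : I → ProbabilityMeasure X} (hη : ∀ i, η i ∈ invariantMeasures T) (w : stdSimplex ℝ I) :
    mixture η w ∈ invariantMeasures T := by
  refine ⟨hT, ?_⟩
  ext s hs
  rw [Measure.map_apply hT hs, toMeasure_mixture]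
  simp only [Measure.finsetSum_apply, Measure.smul_apply]
  refine Finset.sum_congr rfl fun i _ => ?_
  rw [MeasurePreserving.measure_preimage (hη i) hs.nullMeasurableSet]

end Mixture

/-! ### Invariant measures: closedness and existence -/

section Invariant

variable {X : Type*} [MetricSpace X] [MeasurableSpace X] [BorelSpace X] {T : X → X}

theorem mem_invariantMeasures_iff_map_eq (hT : Continuous T) (μ : ProbabilityMeasure X) :
    μ ∈ invariantMeasures T ↔ μ.map hT.measurable.aemeasurable = μ :=
  ⟨fun h => Subtype.ext h.map_eq, fun h => ⟨hT.measurable, congrArg Subtype.val h⟩⟩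

theorem isClosed_invariantMeasures (hT : Continuous T) : IsClosed (invariantMeasures T) := by
  have : invariantMeasures T = {μ | μ.map hT.measurable.aemeasurable = μ} :=
    Set.ext fun μ => mem_invariantMeasures_iff_map_eq hT μ
  rw [this]
  exact isClosed_eq (ProbabilityMeasure.continuous_map hT) continuous_id

/-- **Krylov–Bogoliubov theorem.** -/
theorem invariantMeasures_nonempty [CompactSpace X] [Nonempty X] (hT : Continuous T) :
    (invariantMeasures T).Nonempty := by
  obtain ⟨x⟩ := ‹Nonempty X›
  let w : (n : ℕ) → stdSimplex ℝ (Fin (n + 1)) := fun n =>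
    ⟨fun _ => 1 / (n + 1 : ℝ), fun _ => by positivity, by
      rw [Finset.sum_const, Finset.card_univ, Fintype.card_fin, nsmul_eq_mul]
      push_cast
      field_simp⟩
  let μ : ℕ → ProbabilityMeasure X := fun n =>
    mixture (fun k : Fin (n + 1) => ⟨Measure.dirac (T^[k] x), inferInstance⟩) (w n)
  have hμ : ∀ n (f : X →ᵇ ℝ), ∫ y, f y ∂(μ n : Measure X) =
      1 / (n + 1 : ℝ) * ∑ k ∈ Finset.range (n + 1), f (T^[k] x) := by
    intro n f
    refine (integral_mixture _ _ fun i => f.integrable _).trans ?_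
    rw [Finset.mul_sum, ← Fin.sum_univ_eq_sum_range fun k => 1 / (n + 1 : ℝ) * f (T^[k] x)]
    refine Finset.sum_congr rfl fun k _ => ?_
    simp [w]
  -- Compactness gives a limit of the orbit averages along an ultrafilter; invariance follows
  -- because ∫ f ∘ T − ∫ f telescopes to a boundary term over n + 1.
  obtain ⟨ν, hν⟩ : ∃ ν, Tendsto μ (hyperfilter ℕ : Filter ℕ) (𝓝 ν) :=
    ⟨_, Ultrafilter.le_nhds_lim ((hyperfilter ℕ).map μ)⟩
  refine ⟨ν, (mem_invariantMeasures_iff_map_eq hT ν).2 (Subtype.ext ?_)⟩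
  change (ν.map hT.measurable.aemeasurable : Measure X) = ν
  refine ext_of_forall_integral_eq_of_IsFiniteMeasure fun f => ?_
  have hlim := ProbabilityMeasure.tendsto_iff_forall_integral_tendsto.1 hν
  have hmap : ∫ y, f y ∂(ν.map hT.measurable.aemeasurable : Measure X) =
      ∫ y, f.compContinuous ⟨T, hT⟩ y ∂(ν : Measure X) :=
    integral_map hT.measurable.aemeasurable f.continuous.aestronglyMeasurable
  refine hmap.trans (sub_eq_zero.1 ?_)
  refine tendsto_nhds_unique ((hlim (f.compContinuous ⟨T, hT⟩)).sub (hlim f)) ?_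
  refine Tendsto.mono_left ?_ (Nat.hyperfilter_le_atTop)
  have heq : ∀ n, ∫ y, f.compContinuous ⟨T, hT⟩ y ∂(μ n : Measure X) - ∫ y, f y ∂(μ n : Measure X)
      = 1 / (n + 1 : ℝ) * (f (T^[n + 1] x) - f x) := by
    intro n
    have htel := Finset.sum_range_sub (fun k => f (T^[k] x)) (n + 1)
    rw [Function.iterate_zero_apply] at htel
    rw [hμ, hμ, ← mul_sub, ← Finset.sum_sub_distrib, ← htel]
    simp [Function.iterate_succ_apply']
  simp only [heq]
  refine tendsto_one_div_add_atTop_nhds_zero_nat.zero_mul_isBoundedUnder_le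
    (isBoundedUnder_of ⟨‖f‖ + ‖f‖, fun n => ?_⟩)
  exact (norm_sub_le _ _).trans (add_le_add (f.norm_coe_le_norm _) (f.norm_coe_le_norm _))

end Invariant

/-! ### Continuity and affinity of the payoffs -/

section Payoff

variable {X Y : Type*} [MetricSpace X] [MetricSpace Y] {A : X × Y → ℝ}

theorem IsLipschitzPotential.continuous (hA : IsLipschitzPotential A) : Continuous A := by
  obtain ⟨L, hL⟩ := hA
  -- The factor 2 passes from the sum metric to the sup metric; `L` may be negative.
  refine (LipschitzWith.of_dist_le_mul (K := ⟨|L| * 2, by positivity⟩) fun p q => ?_).continuous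
  have h1 : dist p.1 q.1 ≤ dist p q := le_max_left _ _
  have h2 : dist p.2 q.2 ≤ dist p q := le_max_right _ _
  calc dist (A p) (A q) ≤ L * (dist p.1 q.1 + dist p.2 q.2) := hL p q
    _ ≤ |L| * (dist p q + dist p q) := by
      gcongr
      exact le_abs_self L
    _ = |L| * 2 * dist p q := by ring

variable [CompactSpace X] [MeasurableSpace X] [BorelSpace X]
  [CompactSpace Y] [MeasurableSpace Y] [BorelSpace Y]

theorem continuous_payoff (hA : Continuous A) :
    Continuous fun p : ProbabilityMeasure X × ProbabilityMeasure Y => payoff A p.1 p.2 :=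
  (ProbabilityMeasure.continuous_integral_continuousMap (⟨A, hA⟩ : C(X × Y, ℝ))).comp
    ProbabilityMeasure.continuous_prod

theorem integrable_prod_of_continuous (hA : Continuous A) (μ : ProbabilityMeasure X)
    (ν : ProbabilityMeasure Y) : Integrable A ((μ : Measure X).prod (ν : Measure Y)) :=
  (BoundedContinuousFunction.mkOfCompact ⟨A, hA⟩).integrable _

theorem payoff_mixture_left {I : Type*} [Fintype I] (hA : Continuous A)
    (η : I → ProbabilityMeasure X) (w : stdSimplex ℝ I) (ν : ProbabilityMeasure Y) :
    payoff A (mixture η w) ν = ∑ i, w.1 i * payoff A (η i) ν := by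
  have h := fun μ => integrable_prod_of_continuous hA μ ν
  simp only [payoff]
  rw [integral_prod _ (h _), integral_mixture η w fun i => (h (η i)).integral_prod_left]
  exact Finset.sum_congr rfl fun i _ => by rw [integral_prod _ (h _)]

theorem payoff_mixture_right {I : Type*} [Fintype I] (hA : Continuous A)
    (μ : ProbabilityMeasure X) (η : I → ProbabilityMeasure Y) (w : stdSimplex ℝ I) :
    payoff A μ (mixture η w) = ∑ i, w.1 i * payoff A μ (η i) := by
  have h := fun ν => integrable_prod_of_continuous hA μ ν
  simp only [payoff]
  rw [integral_prod_symm _ (h _), integral_mixture η w fun i => (h (η i)).integral_prod_right]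
  exact Finset.sum_congr rfl fun i _ => by rw [integral_prod_symm _ (h _)]

end Payoff

/-! ### Equilibria from the Nikaidô–Isoda function -/

section Game

variable {X Y : Type*} [MeasurableSpace X] [MeasurableSpace Y]

/-- The Nikaidô–Isoda function: the total gain of the players when each deviates on their own
from the profile `z` to their strategy in `w`. -/
noncomputable def deviationGain (A₁ A₂ : X × Y → ℝ)
    (z w : ProbabilityMeasure X × ProbabilityMeasure Y) : ℝ :=
  (payoff A₁ w.1 z.2 - payoff A₁ z.1 z.2) + (payoff A₂ z.1 w.2 - payoff A₂ z.1 z.2)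

/-- For a unilateral deviation the other player's term vanishes. -/
theorem isNashEquilibrium_of_deviationGain_nonpos {T : X → X} {S : Y → Y} {A₁ A₂ : X × Y → ℝ}
    {z : ProbabilityMeasure X × ProbabilityMeasure Y} (hz₁ : z.1 ∈ invariantMeasures T)
    (hz₂ : z.2 ∈ invariantMeasures S)
    (h : ∀ w ∈ invariantMeasures T ×ˢ invariantMeasures S, deviationGain A₁ A₂ z w ≤ 0) :
    IsNashEquilibrium T S A₁ A₂ z.1 z.2 where
  strategy₁ := hz₁
  strategy₂ := hz₂
  best₁ := ⟨hz₁, fun η hη => by simpa [deviationGain] using h (η, z.2) ⟨hη, hz₂⟩⟩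
  best₂ := ⟨hz₂, fun η hη => by simpa [deviationGain] using h (z.1, η) ⟨hz₁, hη⟩⟩

end Game

end ErgodicGame

theorem theorem3p1 {X Y : Type*}
    [MetricSpace X] [CompactSpace X] [Nonempty X] [MeasurableSpace X] [BorelSpace X]
    [MetricSpace Y] [CompactSpace Y] [Nonempty Y] [MeasurableSpace Y] [BorelSpace Y]
    (T : X → X) (hT : Continuous T) (S : Y → Y) (hS : Continuous S)
    (A₁ A₂ : X × Y → ℝ)
    (hA₁ : ErgodicGame.IsLipschitzPotential A₁) (hA₂ : ErgodicGame.IsLipschitzPotential A₂) :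
    ∃ (μ : ProbabilityMeasure X) (ν : ProbabilityMeasure Y),
      ErgodicGame.IsNashEquilibrium T S A₁ A₂ μ ν := by
  open ErgodicGame in
  have hφ₁ := continuous_payoff hA₁.continuous
  have hφ₂ := continuous_payoff hA₂.continuous
  set K := invariantMeasures T ×ˢ invariantMeasures S with hKdef
  have hK : IsCompact K :=
    ((isClosed_invariantMeasures hT).prod (isClosed_invariantMeasures hS)).isCompact
  obtain ⟨z, hz, hgain⟩ := hK.inter_iInter_nonempty
    (fun w : K => {z | deviationGain A₁ A₂ z w ≤ 0})
    (fun w => isClosed_le (((hφ₁.comp (by fun_prop : Continuous fun z :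
          ProbabilityMeasure X × ProbabilityMeasure Y => (w.1.1, z.2))).sub hφ₁).add
        ((hφ₂.comp (by fun_prop : Continuous fun z :
          ProbabilityMeasure X × ProbabilityMeasure Y => (z.1, w.1.2))).sub hφ₂))
      continuous_const)
    (fun F => by
      -- The simplex over an empty family is empty; there the claim is that `K` is nonempty, by
      -- Krylov–Bogoliubov.
      rcases F.eq_empty_or_nonempty with rfl | hF
      · obtain ⟨μ, hμ⟩ := invariantMeasures_nonempty hT
        obtain ⟨ν, hν⟩ := invariantMeasures_nonempty hS
        exact ⟨(μ, ν), ⟨hμ, hν⟩, by simp⟩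
      have : Nonempty F := hF.to_subtype
      let mix : stdSimplex ℝ F → ProbabilityMeasure X × ProbabilityMeasure Y := fun x =>
        (mixture (fun i : F => i.1.1.1) x, mixture (fun i : F => i.1.1.2) x)
      have hmix : Continuous mix := (continuous_mixture _).prodMk (continuous_mixture _)
      obtain ⟨x, hx⟩ := Scarf.exists_stdSimplex_nonpos
        (fun x (i : F) => deviationGain A₁ A₂ (mix x) i.1.1)
        (continuous_pi fun i =>
          ((hφ₁.comp (continuous_const.prodMk hmix.snd)).sub (hφ₁.comp hmix)).add
            ((hφ₂.comp (hmix.fst.prodMk continuous_const)).sub (hφ₂.comp hmix)))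
        -- Averaging the deviations with weights `x` returns `mix x` itself, so the mean gain is
        -- zero.
        (fun x => by
          simp only [deviationGain, mul_add, mul_sub, Finset.sum_add_distrib,
            Finset.sum_sub_distrib, ← Finset.sum_mul, x.2.2, one_mul]
          have h₁ := payoff_mixture_left hA₁.continuous (fun i : F => i.1.1.1) x (mix x).2
          have h₂ := payoff_mixture_right hA₂.continuous (mix x).1 (fun i : F => i.1.1.2) x
          rw [← h₁, ← h₂]
          simp [mix])
      refine ⟨mix x, ⟨mixture_mem_invariantMeasures hT.measurable (fun i => i.1.2.1) x,
        mixture_mem_invariantMeasures hS.measurable (fun i => i.1.2.2) x⟩, ?_⟩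
      simp only [Set.mem_iInter]
      exact fun w hw => hx ⟨w, hw⟩)
  exact ⟨z.1, z.2, isNashEquilibrium_of_deviationGain_nonpos hz.1 hz.2 fun w hw =>
    Set.mem_iInter.1 hgain ⟨w, hw⟩⟩
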